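/- \textbf{Definitions.} Let $n\ge 1$. A \emph{selector} is a continuous function $H:\mathbb R^n\to\mathbb R$ with $H(x_1,\dots,x_n)\in\{x_1,\dots,x_n\}$ for all $x\in\mathbb R^n$. A \emph{Sperner family} is a nonempty collection $\mathcal S=\{A_1,\dots,A_k\}$ of nonempty subsets of $\{1,\dots,n\}$, none of which is contained in another; its \emph{Sperner statistic} is $H_{\mathcal S}(x)=\max_{1\le j\le k}\min_{i\in A_j}x_i$. For a measurable $H:\mathbb R^n\to\mathbb R$ and a real random variable $X$, let $\mathbf H(X)=H(X_1,\dots,X_n)$, where $X_1,\dots,X_n$ are independent copies of $X$; this is determined in law, and $\mathbf H^{(N)}$ denotes the $N$-th iterate of $\mathbf H$. A \emph{module} of $H$ is a function $h:[0,1]\to[0,1]$ such that $F_{\mathbf H(X)}=h\circ F_X$ for every real random variable $X$, where $F_X$ is the distribution function of $X$. A number $\omega$ is a \emph{Sperner point} of $H$ if $H$ has a module $h$ such that either $\omega\in(0,1)$ is the unique fixed point of $h$ in $(0,1)$; or $\omega=0$ and $h(t)>t$ for all $t\in(0,1)$ (upper case); or $\omega=1$ and $h(t)<t$ for all $t\in(0,1)$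 (lower case). For $\eta\in(0,1)$ the \emph{quantile} $Q_X(\eta)$ is a random variable that takes the value $\sup\{t\in\mathbb R:F_X(t)<\eta\}$ with probability $\eta$ and the value $\inf\{t\in\mathbb R:F_X(t)>\eta\}$ with probability $1-\eta$; moreover $Q_X(0)=\inf\{t\in\mathbb R:F_X(t)>0\}\in[-\infty,\infty)$ and $Q_X(1)=\sup\{t\in\mathbb R:F_X(t)<1\}\in(-\infty,\infty]$ are constants. \textbf{Theorem.} A function $H:\mathbb R^n\to\mathbb R$ is a selector if and only if it is a Sperner statistic. Let $H$ be a Sperner statistic that is not a projection $x\mapsto x_i$. Then $H$ has exactly one Sperner point $\omega_H\in[0,1]$. If $H=H_{\mathcal S}$ for a Sperner family $\mathcal S$, then $\omega_H=1$ if and only if $\mathcal S$ contains a singleton and $\bigcap_{A\in\mathcal S}A=\emptyset$, and $\omega_H=0$ if and only if $\mathcal S$ contains no singleton and $\bigcap_{A\in\mathcal S}A\ne\emptyset$. For every real random variable $X$, $$\mathbf H^{(N)}(X)\xrightarrow{\ d\ }Q_X(\omega_H)\qquad (N\to\infty),$$ where convergence in distribution is weak convergence of laws on $[-\infty,\infty]$;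 whenever $Q_X(\omega_H)$ is real-valued (in particular, whenever $\omega_H\in(0,1)$), it is also weak convergence of laws on $\mathbb R$. -/

import Mathlib

open Set Filter Topology MeasureTheory ProbabilityTheory

/-- A Sperner family in an `n`-element index set: a nonempty collection of nonempty subsets,
none of which is contained in another one. -/
structure SpernerFamily (n : ℕ) where
  sets : Finset (Finset (Fin n))
  sets_nonempty : sets.Nonempty
  nonempty_of_mem : ∀ A ∈ sets, A.Nonempty
  antichain : IsAntichain (· ⊆ ·) (sets : Set (Finset (Fin n)))

/-- The function `max (min_{A₁}, …, min_{A_k})`, with `min_A x = min {x i | i ∈ A}`. -/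
def SpernerFamily.statistic {n : ℕ} (S : SpernerFamily n) (x : Fin n → ℝ) : ℝ :=
  S.sets.attach.sup' (Finset.attach_nonempty_iff.mpr S.sets_nonempty)
    (fun A => A.1.inf' (S.nonempty_of_mem A.1 A.2) x)

/-- Some member of the family is a singleton. -/
def SpernerFamily.HasSingleton {n : ℕ} (S : SpernerFamily n) : Prop :=
  ∃ i : Fin n, {i} ∈ S.sets

/-- The members of the family have a common element. -/
def SpernerFamily.HasCommonPoint {n : ℕ} (S : SpernerFamily n) : Prop :=
  ∃ i : Fin n, ∀ A ∈ S.sets, i ∈ A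

/-- `H` is a Sperner statistic. -/
def IsSpernerStatistic {n : ℕ} (H : (Fin n → ℝ) → ℝ) : Prop :=
  ∃ S : SpernerFamily n, H = S.statistic

/-- A selector: a continuous function with `H (x₁, …, xₙ) ∈ {x₁, …, xₙ}`. -/
def IsSelector {n : ℕ} (H : (Fin n → ℝ) → ℝ) : Prop :=
  Continuous H ∧ ∀ x, ∃ i, H x = x i

/-- `H` is the projection onto a single coordinate. -/
def IsProjection {n : ℕ} (H : (Fin n → ℝ) → ℝ) : Prop :=
  ∃ i, H = fun x => x i

/-- The law of `H (X₁, …, Xₙ)`, where `X₁, …, Xₙ` are independent copies of a random variable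
of law `μ`. -/
noncomputable def operatorLaw {n : ℕ} (H : (Fin n → ℝ) → ℝ) (μ : Measure ℝ) : Measure ℝ :=
  (Measure.pi fun _ : Fin n => μ).map H

/-- The law of the `N`-th iterate of the operator of `H`, applied to a random variable of
law `μ`. -/
noncomputable def iterateLaw {n : ℕ} (H : (Fin n → ℝ) → ℝ) (N : ℕ) (μ : Measure ℝ) :
    Measure ℝ :=
  (operatorLaw H)^[N] μ

/-- If `X₁, …, Xₙ` are independent of law `μ`, then `H (X₁, …, Xₙ)` has law
`operatorLaw H μ`. -/
theorem hasLaw_operatorLaw {n : ℕ} {Ω : Type*} [MeasurableSpace Ω] {P : Measure Ω}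
    [IsProbabilityMeasure P] {H : (Fin n → ℝ) → ℝ} (hH : Measurable H) {μ : Measure ℝ}
    {X : Fin n → Ω → ℝ} (hX : ∀ i, HasLaw (X i) μ P) (hind : iIndepFun X P) :
    HasLaw (fun ω => H (fun i => X i ω)) (operatorLaw H μ) P := by
  have hm : ∀ i, AEMeasurable (X i) P := fun i => (hX i).aemeasurable
  have hm' : AEMeasurable (fun ω i => X i ω) P := aemeasurable_pi_lambda _ hm
  refine ⟨hH.comp_aemeasurable hm', ?_⟩
  have h1 := (iIndepFun_iff_map_fun_eq_pi_map hm).1 hind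
  have h2 : P.map (fun ω => H (fun i => X i ω)) = (P.map (fun ω i => X i ω)).map H :=
    (AEMeasurable.map_map_of_aemeasurable hH.aemeasurable hm').symm
  rw [h2, h1, operatorLaw]
  simp only [fun i => (hX i).map_eq]

theorem isProbabilityMeasure_operatorLaw {n : ℕ} {H : (Fin n → ℝ) → ℝ} (hH : Measurable H)
    (μ : Measure ℝ) [IsProbabilityMeasure μ] : IsProbabilityMeasure (operatorLaw H μ) :=
  Measure.isProbabilityMeasure_map hH.aemeasurable

/-- `h`, as a function on `[0, 1]`, is the module of the conservative statistic `H`: for every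
random variable `X`, the distribution function of `H (X₁, …, Xₙ)` is `h ∘ F_X`. -/
def IsModule {n : ℕ} (H : (Fin n → ℝ) → ℝ) (h : ℝ → ℝ) : Prop :=
  Measurable H ∧ MapsTo h (Icc 0 1) (Icc 0 1) ∧
    ∀ μ : Measure ℝ, IsProbabilityMeasure μ → ∀ t : ℝ, cdf (operatorLaw H μ) t = h (cdf μ t)

/-- `ω` is the Sperner point of `H`, whose module is `h`: the unique fixed point of `h` in
`(0, 1)`; or `0` in the upper case `h t > t` on `(0, 1)`; or `1` in the lower case `h t < t`
on `(0, 1)`. -/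
def IsSpernerPoint {n : ℕ} (H : (Fin n → ℝ) → ℝ) (ω : ℝ) : Prop :=
  ∃ h : ℝ → ℝ, IsModule H h ∧
    ((ω ∈ Ioo (0 : ℝ) 1 ∧ ∀ t ∈ Ioo (0 : ℝ) 1, h t = t ↔ t = ω) ∨
      (ω = 0 ∧ ∀ t ∈ Ioo (0 : ℝ) 1, t < h t) ∨
      (ω = 1 ∧ ∀ t ∈ Ioo (0 : ℝ) 1, h t < t))

/-- `sup {t ∈ ℝ | F t < η}`, as an extended real, where `F` is the distribution function
of `μ`. -/
noncomputable def leftQuantile (μ : Measure ℝ) (η : ℝ) : EReal :=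
  sSup ((fun t : ℝ => (t : EReal)) '' {t : ℝ | cdf μ t < η})

/-- `inf {t ∈ ℝ | F t > η}`, as an extended real, where `F` is the distribution function
of `μ`. -/
noncomputable def rightQuantile (μ : Measure ℝ) (η : ℝ) : EReal :=
  sInf ((fun t : ℝ => (t : EReal)) '' {t : ℝ | η < cdf μ t})

/-- The law of the `η`-quantile of a random variable `X` of law `μ`, `0 ≤ η ≤ 1`: it takes the
value `sup {F_X < η}` with probability `η` and the value `inf {F_X > η}` with probability
`1 - η`. For `η = 0` (`η = 1`) this is the point mass at the essential infimum (supremum) of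
`X`, which may be infinite; see the two lemmas below. -/
noncomputable def quantileLaw (μ : Measure ℝ) (η : ℝ) : Measure EReal :=
  ENNReal.ofReal η • Measure.dirac (leftQuantile μ η) +
    ENNReal.ofReal (1 - η) • Measure.dirac (rightQuantile μ η)

theorem quantileLaw_zero (μ : Measure ℝ) :
    quantileLaw μ 0 =
      Measure.dirac (sInf ((fun t : ℝ => (t : EReal)) '' {t : ℝ | 0 < cdf μ t})) := by
  simp [quantileLaw, rightQuantile]

theorem quantileLaw_one (μ : Measure ℝ) :
    quantileLaw μ 1 =
      Measure.dirac (sSup ((fun t : ℝ => (t : EReal)) '' {t : ℝ | cdf μ t < 1})) := by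
  simp [quantileLaw, leftQuantile]

/-!
A selector commutes with thresholds: whether `H x` exceeds `t` depends only on which coordinates
exceed `t`. Along a segment that keeps this set of coordinates fixed, `H` takes its values either
from those above the moving threshold or from those below it, and by connectedness it cannot switch
(`IsSelector.lt_of_lt`). Hence `H` is described by a monotone family of sets, and its minimal
members form the Sperner family (`IsSelector.isSpernerStatistic`).

For a Sperner statistic, `H x ≤ t` says that the coordinates with `x i ≤ t` meet every member of the
family, so the module is the reliability polynomial `h` of this monotone event
(`SpernerFamily.cdf_operatorLaw`). The heart of the argument is the Moore–Shannon inequality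
`t (1 - t) h' > h (1 - h)` on `(0, 1)`, valid unless the event is constant or is decided by one
coordinate (`mooreShannon_pos`). It is proved by conditioning on one coordinate, and it makes the
difference of the log-odds of `h t` and `t` strictly increasing, so that `h` crosses the diagonal at
most once, and upwards (`reliability_crossing`). A singleton in the family gives `h t ≤ t` and a
common point gives `t ≤ h t`; if there is neither, `h` has derivative zero at its fixed
points `0` and `1`, and the intermediate value theorem gives a fixed point inside
(`SpernerFamily.exists_isSpernerPoint`).

The crossing point `ω` is thus repelling: the iterates of `h` tend to `0` below `ω`, to `1` above it,
and stay at `ω` (`SpernerFamily.tendsto_iterate`). The distribution functions of the iterated laws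
are these iterates evaluated at the distribution function of `X`, so they converge to `0` left of the
left quantile, to `1` right of the right quantile and to `ω` in between. The lower bound of the
portmanteau theorem for open sets follows for the two-point limit law (`twoPoint_le_liminf`).
-/

/-! ### Selectors and Sperner statistics -/

theorem SpernerFamily.lt_statistic_iff {n : ℕ} (S : SpernerFamily n) (x : Fin n → ℝ) (t : ℝ) :
    t < S.statistic x ↔ ∃ A ∈ S.sets, ∀ i ∈ A, t < x i := by
  simp only [statistic, Finset.lt_sup'_iff, Finset.lt_inf'_iff, Finset.mem_attach, true_and,
    Subtype.exists, exists_prop]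

theorem SpernerFamily.statistic_le_iff {n : ℕ} (S : SpernerFamily n) (x : Fin n → ℝ) (t : ℝ) :
    S.statistic x ≤ t ↔ ∀ A ∈ S.sets, ∃ i ∈ A, x i ≤ t := by
  rw [← not_lt, S.lt_statistic_iff]
  push Not
  rfl

theorem SpernerFamily.continuous_statistic {n : ℕ} (S : SpernerFamily n) :
    Continuous S.statistic := by
  unfold statistic
  refine Continuous.finset_sup'_apply _ fun A _ => ?_
  exact Continuous.finset_inf'_apply _ fun i _ => continuous_apply i

theorem SpernerFamily.isSelector_statistic {n : ℕ} (S : SpernerFamily n) :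
    IsSelector S.statistic := by
  refine ⟨S.continuous_statistic, fun x => ?_⟩
  obtain ⟨A, -, hA⟩ := Finset.exists_mem_eq_sup' (Finset.attach_nonempty_iff.mpr S.sets_nonempty)
    (fun A : S.sets => A.1.inf' (S.nonempty_of_mem A.1 A.2) x)
  obtain ⟨i, -, hi⟩ := Finset.exists_mem_eq_inf' (S.nonempty_of_mem A.1 A.2) x
  exact ⟨i, hA.trans hi⟩

/-- Whether a selector exceeds a threshold depends only on the set of coordinates that do. Along
the segment between two configurations with the same such set, the value of the selector is taken
from the coordinates above the moving threshold or from those below; both conditions are closed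
and they exclude each other, so that one of them holds throughout. -/
theorem IsSelector.lt_of_lt {n : ℕ} {H : (Fin n → ℝ) → ℝ} (hH : IsSelector H)
    {x y : Fin n → ℝ} {s t : ℝ} (hxy : ∀ i, s < x i ↔ t < y i) (h : s < H x) : t < H y := by
  let z : ℝ → Fin n → ℝ := fun u i => (1 - u) * x i + u * y i
  let τ : ℝ → ℝ := fun u => (1 - u) * s + u * t
  have hz : Continuous z := by fun_prop
  have hzu : ∀ u ∈ Icc (0 : ℝ) 1, ∀ i, s < x i → τ u < z u i := by
    intro u hu i hi
    have hi' := (hxy i).1 hi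
    have h0 := hu.1
    have h1 : 0 ≤ 1 - u := sub_nonneg.2 hu.2
    simp only [z, τ]
    rcases h0.eq_or_lt with rfl | h0
    · simpa using hi
    · nlinarith
  have hzl : ∀ u ∈ Icc (0 : ℝ) 1, ∀ i, ¬ s < x i → z u i ≤ τ u := by
    intro u hu i hi
    have hi' := not_lt.1 ((hxy i).not.1 hi)
    have hi := not_lt.1 hi
    have h0 := hu.1
    have h1 : 0 ≤ 1 - u := sub_nonneg.2 hu.2
    simp only [z, τ]
    gcongr
  have hclosed : ∀ p : Fin n → Prop, IsClosed {u | ∃ i, p i ∧ H (z u) = z u i} := by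
    intro p
    have : {u | ∃ i, p i ∧ H (z u) = z u i} = ⋃ i ∈ {i | p i}, {u | H (z u) = z u i} := by
      ext u; simp
    rw [this]
    refine (Set.toFinite _).isClosed_biUnion fun i _ => ?_
    exact isClosed_eq (hH.1.comp hz) ((continuous_apply i).comp hz)
  have hdisj : ¬ (Icc (0 : ℝ) 1 ∩ ({u | ∃ i, s < x i ∧ H (z u) = z u i} ∩
      {u | ∃ i, ¬ s < x i ∧ H (z u) = z u i})).Nonempty := by
    rintro ⟨u, hu, ⟨i, hi, hi'⟩, j, hj, hj'⟩
    have := hzu u hu i hi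
    have := hzl u hu j hj
    linarith
  have hcov : Icc (0 : ℝ) 1 ⊆ {u | ∃ i, s < x i ∧ H (z u) = z u i} ∪
      {u | ∃ i, ¬ s < x i ∧ H (z u) = z u i} := by
    intro u _
    obtain ⟨i, hi⟩ := hH.2 (z u)
    by_cases hp : s < x i
    · exact Or.inl ⟨i, hp, hi⟩
    · exact Or.inr ⟨i, hp, hi⟩
  have hz0 : z 0 = x := by ext i; simp [z]
  have hz1 : z 1 = y := by ext i; simp [z]
  have h0 : (0 : ℝ) ∈ {u | ∃ i, s < x i ∧ H (z u) = z u i} := by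
    rcases hcov (left_mem_Icc.2 zero_le_one) with h0 | ⟨i, hi, hi'⟩
    · exact h0
    · rw [hz0] at hi'; exact absurd (hi' ▸ h) hi
  rcases hcov (right_mem_Icc.2 zero_le_one) with ⟨i, hi, hi'⟩ | h1
  · rw [hz1] at hi'
    rw [hi']
    exact (hxy i).1 hi
  · exact absurd (isPreconnected_closed_iff.1 isPreconnected_Icc _ _ (hclosed _) (hclosed _) hcov
      ⟨0, left_mem_Icc.2 zero_le_one, h0⟩ ⟨1, right_mem_Icc.2 zero_le_one, h1⟩) hdisj

theorem IsSelector.exists_lt_of_lt {n : ℕ} {H : (Fin n → ℝ) → ℝ} (hH : IsSelector H)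
    {x : Fin n → ℝ} {t : ℝ} (h : t < H x) : ∃ i, t < x i := by
  obtain ⟨i, hi⟩ := hH.2 x
  exact ⟨i, hi ▸ h⟩

/-- A selector is the Sperner statistic of the minimal sets `C` such that the selector is positive
on the indicator function of `C`. -/
theorem IsSelector.isSpernerStatistic {n : ℕ} {H : (Fin n → ℝ) → ℝ} (hH : IsSelector H) :
    IsSpernerStatistic H := by
  classical
  let g : Finset (Fin n) → Prop := fun C => 0 < H fun i => if i ∈ C then 1 else 0
  have hg : ∀ x t, t < H x ↔ g (Finset.univ.filter fun i => t < x i) := by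
    intro x t
    have : ∀ i, t < x i ↔
        (0 : ℝ) < if i ∈ Finset.univ.filter (fun i => t < x i) then 1 else 0 := by
      intro i
      by_cases hi : t < x i <;> simp [hi]
    exact ⟨hH.lt_of_lt this, hH.lt_of_lt fun i => (this i).symm⟩
  have hmono : ∀ B C, B ⊆ C → g B → g C := by
    intro B C hBC hB
    -- `B` and `C` are the superlevel sets of this vector at the thresholds `1` and `0`.
    let x : Fin n → ℝ := fun i => if i ∈ B then 2 else if i ∈ C then 1 else 0
    have hxB : (Finset.univ.filter fun i => 1 < x i) = B := by
      ext i
      by_cases h1 : i ∈ B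
      · simp [x, h1]
      · by_cases h2 : i ∈ C <;> simp [x, h1, h2]
    have hxC : (Finset.univ.filter fun i => 0 < x i) = C := by
      ext i
      by_cases h1 : i ∈ B
      · simp [x, h1, hBC h1]
      · by_cases h2 : i ∈ C <;> simp [x, h1, h2]
    have h1 : 1 < H x := (hg x 1).2 (hxB.symm ▸ hB)
    exact hxC ▸ (hg x 0).1 (by linarith)
  have hempty : ¬ g ∅ := by
    intro h
    obtain ⟨i, hi⟩ := hH.exists_lt_of_lt h
    simp at hi
  have huniv : g Finset.univ := by
    obtain ⟨i, hi⟩ := hH.2 fun _ => 1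
    simp [g, hi]
  let T : Finset (Finset (Fin n)) := Finset.univ.filter fun C => Minimal g C
  have hT : ∀ C, C ∈ T ↔ Minimal g C := fun C => by simp [T]
  have hbelow : ∀ C, g C → ∃ A ∈ T, A ⊆ C := by
    intro C hC
    obtain ⟨A, hAC, hA⟩ := exists_minimal_le_of_wellFoundedLT g C hC
    exact ⟨A, (hT A).2 hA, hAC⟩
  let S : SpernerFamily n :=
    { sets := T
      sets_nonempty := by
        obtain ⟨A, hA, -⟩ := hbelow _ huniv
        exact ⟨A, hA⟩
      nonempty_of_mem := by
        intro A hA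
        rw [Finset.nonempty_iff_ne_empty]
        rintro rfl
        exact hempty ((hT _).1 hA).prop
      antichain := by
        intro A hA B hB hne hAB
        exact hne (((hT B).1 hB).eq_of_le ((hT A).1 hA).prop hAB) }
  refine ⟨S, funext fun x => eq_of_forall_lt_iff fun t => ?_⟩
  rw [hg, S.lt_statistic_iff]
  constructor
  · intro h
    obtain ⟨A, hA, hsub⟩ := hbelow _ h
    exact ⟨A, hA, fun i hi => (Finset.mem_filter.1 (hsub hi)).2⟩
  · rintro ⟨A, hA, hlt⟩
    exact hmono A _ (fun i hi => by simpa using hlt i hi) ((hT A).1 hA).prop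

theorem isSelector_iff_isSpernerStatistic {n : ℕ} (H : (Fin n → ℝ) → ℝ) :
    IsSelector H ↔ IsSpernerStatistic H := by
  refine ⟨IsSelector.isSpernerStatistic, ?_⟩
  rintro ⟨S, rfl⟩
  exact S.isSelector_statistic

/-! ### Reliability polynomials -/

open Polynomial in
/-- The reliability polynomial of an event `f` about `n` independent coordinates: its value at `t`
is the probability of `f` when every coordinate is true with probability `t`. It is defined by
conditioning on the first coordinate. -/
noncomputable def reliability : (n : ℕ) → ((Fin n → Prop) → Prop) → ℝ[X]
  | 0, f => open Classical in if f Fin.elim0 then 1 else 0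
  | n + 1, f => X * reliability n (fun x => f (Matrix.vecCons True x)) +
      (1 - X) * reliability n (fun x => f (Matrix.vecCons False x))

theorem reliability_succ_eval {n : ℕ} (f : (Fin (n + 1) → Prop) → Prop) (t : ℝ) :
    (reliability (n + 1) f).eval t =
      t * (reliability n (fun x => f (Matrix.vecCons True x))).eval t +
        (1 - t) * (reliability n (fun x => f (Matrix.vecCons False x))).eval t := by
  simp [reliability]

theorem reliability_succ_derivative_eval {n : ℕ} (f : (Fin (n + 1) → Prop) → Prop) (t : ℝ) :
    (reliability (n + 1) f).derivative.eval t =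
      (reliability n (fun x => f (Matrix.vecCons True x))).eval t -
        (reliability n (fun x => f (Matrix.vecCons False x))).eval t +
      t * (reliability n (fun x => f (Matrix.vecCons True x))).derivative.eval t +
        (1 - t) * (reliability n (fun x => f (Matrix.vecCons False x))).derivative.eval t := by
  simp [reliability]
  ring

theorem forall_fin_succ_prop {n : ℕ} {p : (Fin (n + 1) → Prop) → Prop} :
    (∀ x, p x) ↔ (∀ x, p (Matrix.vecCons True x)) ∧ ∀ x, p (Matrix.vecCons False x) := by
  refine ⟨fun h => ⟨fun x => h _, fun x => h _⟩, fun h x => ?_⟩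
  rw [← Matrix.cons_head_tail x]
  by_cases h0 : Matrix.vecHead x
  · rw [eq_true h0]; exact h.1 _
  · rw [eq_false h0]; exact h.2 _

theorem reliability_false (n : ℕ) : reliability n (fun _ => False) = 0 := by
  induction n with
  | zero => simp [reliability]
  | succ n ih => simp [reliability, ih]

theorem reliability_true (n : ℕ) : reliability n (fun _ => True) = 1 := by
  induction n with
  | zero => simp [reliability]
  | succ n ih => simp [reliability, ih]

theorem reliability_proj {n : ℕ} (i : Fin n) :
    reliability n (fun x => x i) = Polynomial.X := by
  induction n with
  | zero => exact i.elim0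
  | succ n ih =>
    refine Fin.cases ?_ (fun j => ?_) i
    · simp [reliability, reliability_true, reliability_false]
    · simp only [reliability, Matrix.cons_val_succ, ih j]; ring

theorem reliability_mono {n : ℕ} {f g : (Fin n → Prop) → Prop} (h : ∀ x, f x → g x) {t : ℝ}
    (ht : t ∈ Icc (0 : ℝ) 1) : (reliability n f).eval t ≤ (reliability n g).eval t := by
  induction n with
  | zero =>
    have := h Fin.elim0
    by_cases h1 : f Fin.elim0 <;> by_cases h2 : g Fin.elim0 <;> simp_all [reliability]
  | succ n ih =>
    rw [reliability_succ_eval, reliability_succ_eval]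
    have h1 := ih (fun x => h (Matrix.vecCons True x))
    have h2 := ih (fun x => h (Matrix.vecCons False x))
    have := ht.1
    have : 0 ≤ 1 - t := sub_nonneg.2 ht.2
    gcongr

theorem reliability_strict_mono {n : ℕ} {f g : (Fin n → Prop) → Prop} (h : ∀ x, f x → g x)
    (hne : ∃ x, ¬ f x ∧ g x) {t : ℝ} (ht : t ∈ Ioo (0 : ℝ) 1) :
    (reliability n f).eval t < (reliability n g).eval t := by
  induction n with
  | zero =>
    obtain ⟨x, hx⟩ := hne
    rw [Subsingleton.elim x Fin.elim0] at hx
    simp [reliability, hx.1, hx.2]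
  | succ n ih =>
    rw [reliability_succ_eval, reliability_succ_eval]
    have h1 := reliability_mono (fun x => h (Matrix.vecCons True x)) (Ioo_subset_Icc_self ht)
    have h2 := reliability_mono (fun x => h (Matrix.vecCons False x)) (Ioo_subset_Icc_self ht)
    have h0 := ht.1
    have h0' : 0 < 1 - t := sub_pos.2 ht.2
    by_cases hT : ∃ x, ¬ f (Matrix.vecCons True x) ∧ g (Matrix.vecCons True x)
    · exact add_lt_add_of_lt_of_le
        (mul_lt_mul_of_pos_left (ih (fun x => h (Matrix.vecCons True x)) hT) h0)
        (mul_le_mul_of_nonneg_left h2 h0'.le)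
    · have hF : ∃ x, ¬ f (Matrix.vecCons False x) ∧ g (Matrix.vecCons False x) := by
        by_contra hF
        exact not_forall_not.2 hne (forall_fin_succ_prop.2 ⟨not_exists.1 hT, not_exists.1 hF⟩)
      exact add_lt_add_of_le_of_lt (mul_le_mul_of_nonneg_left h1 h0.le)
        (mul_lt_mul_of_pos_left (ih (fun x => h (Matrix.vecCons False x)) hF) h0')

theorem reliability_mem_Icc {n : ℕ} (f : (Fin n → Prop) → Prop) {t : ℝ}
    (ht : t ∈ Icc (0 : ℝ) 1) : (reliability n f).eval t ∈ Icc (0 : ℝ) 1 := by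
  have h1 := reliability_mono (f := fun _ => False) (g := f) (fun x => False.elim) ht
  have h2 := reliability_mono (f := f) (g := fun _ => True) (fun x _ => trivial) ht
  simp only [reliability_false, reliability_true, Polynomial.eval_zero, Polynomial.eval_one]
    at h1 h2
  exact ⟨h1, h2⟩

theorem reliability_pos {n : ℕ} {f : (Fin n → Prop) → Prop} (hf : ∃ x, f x) {t : ℝ}
    (ht : t ∈ Ioo (0 : ℝ) 1) : 0 < (reliability n f).eval t := by
  have := reliability_strict_mono (f := fun _ => False) (g := f) (fun x => False.elim)
    (by simpa using hf) ht
  simpa [reliability_false] using this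

theorem reliability_lt_one {n : ℕ} {f : (Fin n → Prop) → Prop} (hf : ∃ x, ¬ f x) {t : ℝ}
    (ht : t ∈ Ioo (0 : ℝ) 1) : (reliability n f).eval t < 1 := by
  have := reliability_strict_mono (f := f) (g := fun _ => True) (fun x _ => trivial)
    (by simpa using hf) ht
  simpa [reliability_true] using this

/-! ### The Moore–Shannon inequality -/

theorem vecCons_mono_left {n : ℕ} {f : (Fin (n + 1) → Prop) → Prop} (hf : Monotone f)
    (x : Fin n → Prop) (h : f (Matrix.vecCons False x)) : f (Matrix.vecCons True x) := by
  refine hf (fun i => ?_) h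
  refine Fin.cases ?_ (fun j => ?_) i <;> simp

theorem Monotone.comp_vecCons {n : ℕ} {f : (Fin (n + 1) → Prop) → Prop} (hf : Monotone f) (p : Prop) :
    Monotone fun x => f (Matrix.vecCons p x) := by
  intro x y hxy
  refine hf (fun i => ?_)
  refine Fin.cases ?_ (fun j => ?_) i
  · simp
  · simpa using hxy j

/-- Conditioning on the first coordinate splits the Moore–Shannon defect
`t (1 - t) h' - h (1 - h)` into the defects of the two conditional events and a remainder. -/
theorem mooreShannon_succ {n : ℕ} (f : (Fin (n + 1) → Prop) → Prop) (t : ℝ) :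
    t * (1 - t) * (reliability (n + 1) f).derivative.eval t -
        (reliability (n + 1) f).eval t * (1 - (reliability (n + 1) f).eval t) =
      t * (t * (1 - t) * (reliability n fun x => f (Matrix.vecCons True x)).derivative.eval t -
          (reliability n fun x => f (Matrix.vecCons True x)).eval t *
            (1 - (reliability n fun x => f (Matrix.vecCons True x)).eval t)) +
        (1 - t) *
          (t * (1 - t) * (reliability n fun x => f (Matrix.vecCons False x)).derivative.eval t -
          (reliability n fun x => f (Matrix.vecCons False x)).eval t *
            (1 - (reliability n fun x => f (Matrix.vecCons False x)).eval t)) +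
        t * (1 - t) * (((reliability n fun x => f (Matrix.vecCons True x)).eval t -
            (reliability n fun x => f (Matrix.vecCons False x)).eval t) *
          (1 - ((reliability n fun x => f (Matrix.vecCons True x)).eval t -
            (reliability n fun x => f (Matrix.vecCons False x)).eval t))) := by
  rw [reliability_succ_eval, reliability_succ_derivative_eval]
  ring

theorem mooreShannon_nonneg {n : ℕ} {f : (Fin n → Prop) → Prop} (hf : Monotone f) {t : ℝ}
    (ht : t ∈ Ioo (0 : ℝ) 1) :
    0 ≤ t * (1 - t) * (reliability n f).derivative.eval t -
      (reliability n f).eval t * (1 - (reliability n f).eval t) := by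
  induction n with
  | zero => by_cases h : f Fin.elim0 <;> simp [reliability, h]
  | succ n ih =>
    rw [mooreShannon_succ]
    have h1 := ih (Monotone.comp_vecCons hf True)
    have h0 := ih (Monotone.comp_vecCons hf False)
    have hle := reliability_mono (vecCons_mono_left hf) (Ioo_subset_Icc_self ht)
    have hT := reliability_mem_Icc (fun x => f (Matrix.vecCons True x)) (Ioo_subset_Icc_self ht)
    have hF := reliability_mem_Icc (fun x => f (Matrix.vecCons False x)) (Ioo_subset_Icc_self ht)
    have ht0 := ht.1.le
    have ht1 : 0 ≤ 1 - t := sub_nonneg.2 ht.2.le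
    have hd := mul_nonneg (sub_nonneg.2 hle)
      (by linarith [hT.2, hF.1] : 0 ≤ 1 - ((reliability n fun x => f (Matrix.vecCons True x)).eval t
        - (reliability n fun x => f (Matrix.vecCons False x)).eval t))
    positivity

/-- The strict Moore–Shannon inequality: equality would force every step of the conditioning
to be degenerate, so that the event is constant or is the truth of one coordinate. -/
theorem mooreShannon_pos {n : ℕ} {f : (Fin n → Prop) → Prop} (hf : Monotone f)
    (hT : ∃ x, f x) (hF : ∃ x, ¬ f x) (hproj : ∀ i, ¬ ∀ x, f x ↔ x i) {t : ℝ}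
    (ht : t ∈ Ioo (0 : ℝ) 1) :
    0 < t * (1 - t) * (reliability n f).derivative.eval t -
      (reliability n f).eval t * (1 - (reliability n f).eval t) := by
  induction n with
  | zero =>
    obtain ⟨x, hx⟩ := hT
    obtain ⟨y, hy⟩ := hF
    exact absurd (Subsingleton.elim x y ▸ hx) hy
  | succ n ih =>
    rw [mooreShannon_succ]
    have ht0 := ht.1
    have ht1 : 0 < 1 - t := sub_pos.2 ht.2
    by_cases hdep : ∃ x, ¬ f (Matrix.vecCons False x) ∧ f (Matrix.vecCons True x)
    · have h1 := mooreShannon_nonneg (Monotone.comp_vecCons hf True) ht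
      have h0 := mooreShannon_nonneg (Monotone.comp_vecCons hf False) ht
      have hlt := reliability_strict_mono (vecCons_mono_left hf) hdep ht
      have h1' := (reliability_mem_Icc (fun x => f (Matrix.vecCons True x))
        (Ioo_subset_Icc_self ht)).2
      have h0' := (reliability_mem_Icc (fun x => f (Matrix.vecCons False x))
        (Ioo_subset_Icc_self ht)).1
      have hlt' : 0 < 1 - ((reliability n fun x => f (Matrix.vecCons True x)).eval t
          - (reliability n fun x => f (Matrix.vecCons False x)).eval t) := by
        by_cases hnT : ∃ x, ¬ f (Matrix.vecCons True x)
        · linarith [reliability_lt_one hnT ht]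
        · by_cases hnF : ∃ x, f (Matrix.vecCons False x)
          · linarith [reliability_pos hnF ht]
          · push Not at hnT hnF
            refine absurd (forall_fin_succ_prop.2 ⟨fun x => ?_, fun x => ?_⟩) (hproj 0)
            · simpa using hnT x
            · simpa using hnF x
      have hd := mul_pos (sub_pos.2 hlt) hlt'
      positivity
    · have heq : ∀ x, f (Matrix.vecCons True x) ↔ f (Matrix.vecCons False x) := fun x =>
        ⟨fun h => by_contra fun h' => hdep ⟨x, h', h⟩, vecCons_mono_left hf x⟩
      have hT' : ∃ x, f (Matrix.vecCons False x) := by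
        by_contra h
        push Not at h
        obtain ⟨x, hx⟩ := hT
        exact (forall_fin_succ_prop (p := fun x => ¬ f x)).2
          ⟨fun x => by rw [heq]; exact h x, h⟩ x hx
      have hF' : ∃ x, ¬ f (Matrix.vecCons False x) := by
        by_contra h
        push Not at h
        obtain ⟨x, hx⟩ := hF
        exact hx (forall_fin_succ_prop.2 ⟨fun x => (heq x).2 (h x), h⟩ x)
      have hpos := ih (Monotone.comp_vecCons hf False) hT' hF' fun i h => hproj i.succ
        (forall_fin_succ_prop.2 ⟨fun x => by simpa [heq] using h x, fun x => by simpa using h x⟩)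
      simp only [heq, sub_self, zero_mul, mul_zero, add_zero]
      positivity

/-! ### Behaviour at the endpoints -/

theorem vecCons_true_eq_single {n : ℕ} :
    Matrix.vecCons True (fun _ : Fin n => False) = fun j => j = 0 := by
  ext i; refine Fin.cases ?_ (fun j => ?_) i <;> simp

theorem vecCons_false_single {n : ℕ} (i : Fin n) :
    Matrix.vecCons False (fun j => j = i) = fun j => j = i.succ := by
  ext k; refine Fin.cases ?_ (fun j => ?_) k <;> simp [(Fin.succ_ne_zero _).symm]

theorem vecCons_false_eq_ne {n : ℕ} :
    Matrix.vecCons False (fun _ : Fin n => True) = fun j => j ≠ 0 := by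
  ext i; refine Fin.cases ?_ (fun j => ?_) i <;> simp

theorem vecCons_true_ne {n : ℕ} (i : Fin n) :
    Matrix.vecCons True (fun j => j ≠ i) = fun j => j ≠ i.succ := by
  ext k; refine Fin.cases ?_ (fun j => ?_) k <;> simp [(Fin.succ_ne_zero _).symm]

theorem vecCons_false_const {n : ℕ} :
    Matrix.vecCons False (fun _ : Fin n => False) = fun _ => False := by
  ext i; refine Fin.cases ?_ (fun j => ?_) i <;> simp

theorem vecCons_true_const {n : ℕ} :
    Matrix.vecCons True (fun _ : Fin n => True) = fun _ => True := by
  ext i; refine Fin.cases ?_ (fun j => ?_) i <;> simp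

theorem reliability_eval_zero {n : ℕ} {f : (Fin n → Prop) → Prop} (h : ¬ f fun _ => False) :
    (reliability n f).eval 0 = 0 := by
  induction n with
  | zero =>
    rw [Subsingleton.elim (fun _ => False) Fin.elim0] at h
    simp [reliability, h]
  | succ n ih =>
    rw [reliability_succ_eval, ih (f := fun x => f (Matrix.vecCons False x))]
    · simp
    · rwa [vecCons_false_const]

theorem reliability_eval_one {n : ℕ} {f : (Fin n → Prop) → Prop} (h : f fun _ => True) :
    (reliability n f).eval 1 = 1 := by
  induction n with
  | zero =>
    rw [Subsingleton.elim (fun _ => True) Fin.elim0] at h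
    simp [reliability, h]
  | succ n ih =>
    rw [reliability_succ_eval, ih (f := fun x => f (Matrix.vecCons True x))]
    · simp
    · rwa [vecCons_true_const]

/-- If at least two coordinates have to be true for `f`, its reliability is quadratically small
at `0`. -/
theorem reliability_derivative_eval_zero {n : ℕ} {f : (Fin n → Prop) → Prop}
    (h : ¬ f fun _ => False) (h1 : ∀ i, ¬ f fun j => j = i) :
    (reliability n f).derivative.eval 0 = 0 := by
  induction n with
  | zero => by_cases h : f Fin.elim0 <;> simp [reliability, h]
  | succ n ih =>
    rw [reliability_succ_derivative_eval, reliability_eval_zero, reliability_eval_zero,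
      ih (f := fun x => f (Matrix.vecCons False x))]
    · simp
    · rwa [vecCons_false_const]
    · intro i; rw [vecCons_false_single]; exact h1 _
    · rwa [vecCons_false_const]
    · rw [vecCons_true_eq_single]; exact h1 _

/-- If at least two coordinates have to be false for `f` to fail, its reliability is quadratically
close to `1` at `1`. -/
theorem reliability_derivative_eval_one {n : ℕ} {f : (Fin n → Prop) → Prop}
    (h : f fun _ => True) (h1 : ∀ i, f fun j => j ≠ i) :
    (reliability n f).derivative.eval 1 = 0 := by
  induction n with
  | zero => by_cases h : f Fin.elim0 <;> simp [reliability, h]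
  | succ n ih =>
    rw [reliability_succ_derivative_eval, reliability_eval_one, reliability_eval_one,
      ih (f := fun x => f (Matrix.vecCons True x))]
    · simp
    · rwa [vecCons_true_const]
    · intro i; rw [vecCons_true_ne]; exact h1 _
    · rw [vecCons_false_eq_ne]; exact h1 _
    · rwa [vecCons_true_const]

/-! ### Single crossing of the diagonal -/

/-- The graph of the reliability polynomial crosses the diagonal at most once, and upwards: by the
strict Moore–Shannon inequality, the difference of the log-odds of `h t` and of `t` is strictly
increasing. -/
theorem reliability_crossing {n : ℕ} {f : (Fin n → Prop) → Prop} (hf : Monotone f)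
    (hT : ∃ x, f x) (hF : ∃ x, ¬ f x) (hproj : ∀ i, ¬ ∀ x, f x ↔ x i) {s t : ℝ}
    (hs : s ∈ Ioo (0 : ℝ) 1) (ht : t ∈ Ioo (0 : ℝ) 1) (hst : s < t)
    (h : s ≤ (reliability n f).eval s) : t < (reliability n f).eval t := by
  set g : ℝ → ℝ := fun t => (reliability n f).eval t
  have hg0 : ∀ u ∈ Ioo (0 : ℝ) 1, 0 < g u := fun u hu => reliability_pos hT hu
  have hg1 : ∀ u ∈ Ioo (0 : ℝ) 1, 0 < 1 - g u := fun u hu =>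
    sub_pos.2 (reliability_lt_one hF hu)
  let L : ℝ → ℝ := fun u =>
    Real.log (g u) - Real.log (1 - g u) - (Real.log u - Real.log (1 - u))
  have hL : ∀ u ∈ Ioo (0 : ℝ) 1, HasDerivAt L
      ((reliability n f).derivative.eval u / g u -
        (-(reliability n f).derivative.eval u) / (1 - g u) - (1 / u - (-1) / (1 - u))) u := by
    intro u hu
    have hgd : HasDerivAt g ((reliability n f).derivative.eval u) u :=
      (reliability n f).hasDerivAt u
    have h1 := hgd.log (hg0 u hu).ne'
    have h2 := (hgd.const_sub 1).log (hg1 u hu).ne'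
    have h3 := (hasDerivAt_id u).log hu.1.ne'
    have h4 := ((hasDerivAt_id u).const_sub 1).log (sub_pos.2 hu.2).ne'
    exact (h1.sub h2).sub (h3.sub h4)
  have hmono : StrictMonoOn L (Ioo 0 1) := by
    refine strictMonoOn_of_deriv_pos (convex_Ioo 0 1)
      (fun u hu => (hL u hu).continuousAt.continuousWithinAt) fun u hu => ?_
    rw [interior_Ioo] at hu
    rw [(hL u hu).deriv]
    have h0 := hg0 u hu
    have h1 := hg1 u hu
    have hu0 := hu.1
    have hu1 : 0 < 1 - u := sub_pos.2 hu.2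
    have key := mooreShannon_pos hf hT hF hproj hu
    have : (reliability n f).derivative.eval u / g u -
        (-(reliability n f).derivative.eval u) / (1 - g u) - (1 / u - (-1) / (1 - u)) =
        (u * (1 - u) * (reliability n f).derivative.eval u - g u * (1 - g u)) /
          (g u * (1 - g u) * (u * (1 - u))) := by
      field_simp
      ring
    rw [this]
    exact div_pos key (by positivity)
  have hlt := hmono hs ht hst
  have hLs : 0 ≤ L s := by
    have h1 := Real.log_le_log hs.1 h
    have h2 := Real.log_le_log (hg1 s hs) (sub_le_sub_left h 1)
    simp only [L]; linarith
  by_contra hcon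
  push Not at hcon
  have h1 := Real.log_le_log (hg0 t ht) hcon
  have h2 := Real.log_le_log (sub_pos.2 ht.2) (sub_le_sub_left hcon 1)
  simp only [L] at hlt hLs
  linarith

/-! ### The module of a Sperner statistic -/

/-- The reliability polynomial at `μ s` is the probability of the event for independent samples of
`μ`, when a coordinate counts as true if it lies in `s`. Measurability is part of the statement
because the same induction gives it. -/
theorem measureReal_pi_reliability {n : ℕ} (μ : Measure ℝ) [IsProbabilityMeasure μ] {s : Set ℝ}
    (hs : MeasurableSet s) (f : (Fin n → Prop) → Prop) :
    MeasurableSet {y : Fin n → ℝ | f fun i => y i ∈ s} ∧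
      (Measure.pi fun _ : Fin n => μ).real {y | f fun i => y i ∈ s} =
        (reliability n f).eval (μ.real s) := by
  induction n with
  | zero =>
    have h : ∀ y : Fin 0 → ℝ, (fun i => y i ∈ s) = Fin.elim0 := fun y => Subsingleton.elim _ _
    by_cases hf : f Fin.elim0 <;> simp [h, hf, reliability]
  | succ n ih =>
    obtain ⟨hmT, hT⟩ := ih fun x => f (Matrix.vecCons True x)
    obtain ⟨hmF, hF⟩ := ih fun x => f (Matrix.vecCons False x)
    let e := MeasurableEquiv.piFinSuccAbove (fun _ : Fin (n + 1) => ℝ) 0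
    have he : MeasurePreserving e (Measure.pi fun _ : Fin (n + 1) => μ)
        (μ.prod (Measure.pi fun _ : Fin n => μ)) :=
      measurePreserving_piFinSuccAbove (fun _ : Fin (n + 1) => μ) 0
    have hset : {y : Fin (n + 1) → ℝ | f fun i => y i ∈ s} =
        e ⁻¹' (s ×ˢ {y | f (Matrix.vecCons True fun i => y i ∈ s)} ∪
          sᶜ ×ˢ {y | f (Matrix.vecCons False fun i => y i ∈ s)}) := by
      ext y
      have hy : (fun i => y i ∈ s) = Matrix.vecCons (y 0 ∈ s) fun i : Fin n => y i.succ ∈ s := by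
        ext i
        refine Fin.cases ?_ (fun j => ?_) i <;> simp
      have he0 : (e y).1 = y 0 := rfl
      have he1 : (e y).2 = fun i : Fin n => y i.succ := rfl
      by_cases h0 : y 0 ∈ s <;> simp [hy, he0, he1, h0]
    have hm1 := hs.prod hmT
    have hm2 := hs.compl.prod hmF
    refine ⟨hset ▸ e.measurable (hm1.union hm2), ?_⟩
    rw [hset, he.measureReal_preimage (hm1.union hm2).nullMeasurableSet,
      measureReal_union (Set.disjoint_left.2 fun p hp hp' => hp'.1 hp.1) hm2,
      measureReal_prod_prod, measureReal_prod_prod, hT, hF, probReal_compl_eq_one_sub hs,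
      reliability_succ_eval]

/-- The event that the statistic is at most a threshold, in terms of the coordinates that are at
most the threshold: they have to meet every member of the family. -/
def SpernerFamily.meetsAll {n : ℕ} (S : SpernerFamily n) (x : Fin n → Prop) : Prop :=
  ∀ A ∈ S.sets, ∃ i ∈ A, x i

theorem SpernerFamily.monotone_meetsAll {n : ℕ} (S : SpernerFamily n) : Monotone S.meetsAll :=
  fun _ _ hxy hx A hA => (hx A hA).imp fun i hi => ⟨hi.1, hxy i hi.2⟩

theorem SpernerFamily.meetsAll_true {n : ℕ} (S : SpernerFamily n) :
    S.meetsAll fun _ => True :=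
  fun A hA => (S.nonempty_of_mem A hA).imp fun _ hi => ⟨hi, trivial⟩

theorem SpernerFamily.not_meetsAll_false {n : ℕ} (S : SpernerFamily n) :
    ¬ S.meetsAll fun _ => False := by
  obtain ⟨A, hA⟩ := S.sets_nonempty
  intro h
  obtain ⟨i, -, hi⟩ := h A hA
  exact hi

theorem SpernerFamily.cdf_operatorLaw {n : ℕ} (S : SpernerFamily n) (μ : Measure ℝ)
    [IsProbabilityMeasure μ] (t : ℝ) :
    cdf (operatorLaw S.statistic μ) t = (reliability n S.meetsAll).eval (cdf μ t) := by
  have hm := S.continuous_statistic.measurable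
  have := isProbabilityMeasure_operatorLaw hm μ
  rw [cdf_eq_real, cdf_eq_real, operatorLaw, map_measureReal_apply hm measurableSet_Iic,
    ← (measureReal_pi_reliability μ measurableSet_Iic S.meetsAll).2]
  congr 1
  ext x
  simp [S.statistic_le_iff, meetsAll]

theorem SpernerFamily.isModule {n : ℕ} (S : SpernerFamily n) :
    IsModule S.statistic fun t => (reliability n S.meetsAll).eval t :=
  ⟨S.continuous_statistic.measurable, fun _ ht => reliability_mem_Icc _ ht,
    fun μ _ t => S.cdf_operatorLaw μ t⟩

/-- The module is unique on `[0, 1]`, since every point of it is a value of some distribution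
function. -/
theorem IsModule.eqOn {n : ℕ} {H : (Fin n → ℝ) → ℝ} {h h' : ℝ → ℝ} (hh : IsModule H h)
    (hh' : IsModule H h') : EqOn h h' (Icc 0 1) := by
  intro q hq
  -- The law of a Bernoulli variable that vanishes with probability `q`.
  let μ : Measure ℝ := ENNReal.ofReal q • Measure.dirac 0 + ENNReal.ofReal (1 - q) • Measure.dirac 1
  have hμ : IsProbabilityMeasure μ := ⟨by
    simp [μ, ← ENNReal.ofReal_add hq.1 (sub_nonneg.2 hq.2)]⟩
  have hc : cdf μ 0 = q := by
    rw [cdf_eq_real]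
    simp [μ, measureReal_def, hq.1]
  have h1 := hh.2.2 μ hμ 0
  have h2 := hh'.2.2 μ hμ 0
  rw [hc] at h1 h2
  exact h1.symm.trans h2

theorem SpernerFamily.iterateLaw_cdf {n : ℕ} (S : SpernerFamily n) (N : ℕ) (μ : Measure ℝ)
    [IsProbabilityMeasure μ] :
    IsProbabilityMeasure (iterateLaw S.statistic N μ) ∧ ∀ t, cdf (iterateLaw S.statistic N μ) t =
      (fun u => (reliability n S.meetsAll).eval u)^[N] (cdf μ t) := by
  induction N with
  | zero => exact ⟨‹_›, fun t => rfl⟩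
  | succ N ih =>
    obtain ⟨hp, hc⟩ := ih
    have hstep : iterateLaw S.statistic (N + 1) μ =
        operatorLaw S.statistic (iterateLaw S.statistic N μ) :=
      Function.iterate_succ_apply' _ _ _
    rw [hstep]
    refine ⟨isProbabilityMeasure_operatorLaw S.continuous_statistic.measurable _, fun t => ?_⟩
    rw [S.cdf_operatorLaw, hc, Function.iterate_succ_apply']

theorem SpernerFamily.statistic_eq_of_meetsAll {n : ℕ} {S : SpernerFamily n} {i : Fin n}
    (h : ∀ x, S.meetsAll x ↔ x i) : S.statistic = fun x => x i := by
  funext x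
  refine eq_of_forall_ge_iff fun t => ?_
  rw [S.statistic_le_iff]
  exact h fun j => x j ≤ t

theorem SpernerFamily.meetsAll_single {n : ℕ} {S : SpernerFamily n} {i : Fin n} :
    (S.meetsAll fun j => j = i) ↔ ∀ A ∈ S.sets, i ∈ A := by
  simp [meetsAll]

theorem SpernerFamily.meetsAll_ne {n : ℕ} {S : SpernerFamily n} {i : Fin n} :
    (S.meetsAll fun j => j ≠ i) ↔ {i} ∉ S.sets := by
  constructor
  · intro h hi
    obtain ⟨j, hj, hj'⟩ := h _ hi
    exact hj' (Finset.mem_singleton.1 hj)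
  · intro h A hA
    by_contra hcon
    push Not at hcon
    have : A = {i} := Finset.eq_singleton_iff_nonempty_unique_mem.2 ⟨S.nonempty_of_mem A hA, hcon⟩
    exact h (this ▸ hA)

theorem SpernerFamily.le_reliability {n : ℕ} {S : SpernerFamily n} (h : S.HasCommonPoint) {t : ℝ}
    (ht : t ∈ Icc (0 : ℝ) 1) : t ≤ (reliability n S.meetsAll).eval t := by
  obtain ⟨i, hi⟩ := h
  have := reliability_mono (f := fun x => x i) (g := S.meetsAll)
    (fun x hx A hA => ⟨i, hi A hA, hx⟩) ht
  rwa [reliability_proj, Polynomial.eval_X] at this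

theorem SpernerFamily.reliability_le {n : ℕ} {S : SpernerFamily n} (h : S.HasSingleton) {t : ℝ}
    (ht : t ∈ Icc (0 : ℝ) 1) : (reliability n S.meetsAll).eval t ≤ t := by
  obtain ⟨i, hi⟩ := h
  have := reliability_mono (f := S.meetsAll) (g := fun x => x i) (fun x hx => by
    obtain ⟨j, hj, hj'⟩ := hx _ hi
    exact Finset.mem_singleton.1 hj ▸ hj') ht
  rwa [reliability_proj, Polynomial.eval_X] at this

theorem SpernerFamily.reliability_crossing {n : ℕ} {S : SpernerFamily n}
    (hS : ¬ IsProjection S.statistic) {s t : ℝ} (hs : s ∈ Ioo (0 : ℝ) 1) (ht : t ∈ Ioo (0 : ℝ) 1)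
    (hst : s < t) (h : s ≤ (reliability n S.meetsAll).eval s) :
    t < (reliability n S.meetsAll).eval t :=
  _root_.reliability_crossing S.monotone_meetsAll ⟨_, S.meetsAll_true⟩ ⟨_, S.not_meetsAll_false⟩
    (fun _ hi => hS ⟨_, statistic_eq_of_meetsAll hi⟩) hs ht hst h

theorem SpernerFamily.not_singleton_and_common {n : ℕ} {S : SpernerFamily n}
    (hS : ¬ IsProjection S.statistic) : ¬ (S.HasSingleton ∧ S.HasCommonPoint) := by
  rintro ⟨hs, hc⟩
  have hle := reliability_le (S := S) hs (t := 3 / 4) (by norm_num)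
  have hlt := S.reliability_crossing hS (s := 1 / 2) (t := 3 / 4) (by norm_num) (by norm_num)
    (by norm_num) (le_reliability hc (by norm_num))
  exact hlt.not_ge hle

/-! ### The Sperner point -/

/-- A differentiable function with a fixed point `a` at which its derivative vanishes lies below the
diagonal shortly after `a` and above it shortly before. -/
theorem eventually_lt_of_hasDerivAt_zero {g : ℝ → ℝ} {a : ℝ} (hg : HasDerivAt g 0 a)
    (ha : g a = a) : (∀ᶠ t in 𝓝[>] a, g t < t) ∧ ∀ᶠ t in 𝓝[<] a, t < g t := by
  have h := (hasDerivAt_iff_isLittleO.1 hg).def (c := 1 / 2) (by norm_num)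
  rw [ha] at h
  simp only [smul_zero, sub_zero, Real.norm_eq_abs] at h
  constructor
  · filter_upwards [nhdsWithin_le_nhds h, self_mem_nhdsWithin] with t ht hat
    rw [abs_of_pos (sub_pos.2 hat : 0 < t - a)] at ht
    linarith [(abs_le.1 ht).2, mem_Ioi.1 hat]
  · filter_upwards [nhdsWithin_le_nhds h, self_mem_nhdsWithin] with t ht hat
    rw [abs_of_neg (sub_neg.2 hat : t - a < 0)] at ht
    linarith [(abs_le.1 ht).1, mem_Iio.1 hat]

theorem SpernerFamily.exists_fixedPoint {n : ℕ} {S : SpernerFamily n} (hs : ¬ S.HasSingleton)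
    (hc : ¬ S.HasCommonPoint) :
    ∃ ω ∈ Ioo (0 : ℝ) 1, (reliability n S.meetsAll).eval ω = ω := by
  have hd0 := (reliability n S.meetsAll).hasDerivAt 0
  rw [reliability_derivative_eval_zero S.not_meetsAll_false
    fun i hi => hc ⟨i, meetsAll_single.1 hi⟩] at hd0
  have hd1 := (reliability n S.meetsAll).hasDerivAt 1
  rw [reliability_derivative_eval_one S.meetsAll_true
    fun i => meetsAll_ne.2 fun hi => hs ⟨i, hi⟩] at hd1
  obtain ⟨s, hs1, hs2⟩ := ((eventually_lt_of_hasDerivAt_zero hd0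
    (reliability_eval_zero S.not_meetsAll_false)).1.and
      (Ioo_mem_nhdsGT (show (0 : ℝ) < 1 / 2 by norm_num))).exists
  obtain ⟨t, ht1, ht2⟩ := ((eventually_lt_of_hasDerivAt_zero hd1
    (reliability_eval_one S.meetsAll_true)).2.and
      (Ioo_mem_nhdsLT (show (1 / 2 : ℝ) < 1 by norm_num))).exists
  have hst : s ≤ t := (hs2.2.trans ht2.1).le
  obtain ⟨ω, hω, hω'⟩ := intermediate_value_Icc hst
    (f := fun u => (reliability n S.meetsAll).eval u - u)
    (((reliability n S.meetsAll).continuous.sub continuous_id).continuousOn)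
    (show (0 : ℝ) ∈ _ from ⟨(sub_neg.2 hs1).le, (sub_pos.2 ht1).le⟩)
  exact ⟨ω, ⟨hs2.1.trans_le hω.1, hω.2.trans_lt ht2.2⟩, sub_eq_zero.1 hω'⟩

/-- The graph of `g` lies below the diagonal left of `ω` and above it right of `ω`, inside `(0, 1)`.
The endpoints `ω = 0` and `ω = 1` stand for a graph entirely above or entirely below the diagonal;
no value of `g` at `ω` is prescribed. -/
def CrossesAt (g : ℝ → ℝ) (ω : ℝ) : Prop :=
  ω ∈ Icc (0 : ℝ) 1 ∧ (∀ t ∈ Ioo (0 : ℝ) 1, t < ω → g t < t) ∧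
    ∀ t ∈ Ioo (0 : ℝ) 1, ω < t → t < g t

theorem CrossesAt.unique {g : ℝ → ℝ} {ω ω' : ℝ} (h : CrossesAt g ω) (h' : CrossesAt g ω') :
    ω = ω' := by
  by_contra hne
  wlog hlt : ω < ω' generalizing ω ω'
  · exact this h' h (Ne.symm hne) (lt_of_le_of_ne (not_lt.1 hlt) (Ne.symm hne))
  obtain ⟨t, ht, ht'⟩ := exists_between hlt
  have ht01 : t ∈ Ioo (0 : ℝ) 1 := ⟨h.1.1.trans_lt ht, ht'.trans_le h'.1.2⟩
  exact lt_asymm (h.2.2 t ht01 ht) (h'.2.1 t ht01 ht')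

theorem SpernerFamily.isSpernerPoint_iff {n : ℕ} {S : SpernerFamily n}
    (hS : ¬ IsProjection S.statistic) (ω : ℝ) :
    IsSpernerPoint S.statistic ω ↔
      CrossesAt (fun t => (reliability n S.meetsAll).eval t) ω ∧
        (ω ∈ Ioo (0 : ℝ) 1 → (reliability n S.meetsAll).eval ω = ω) := by
  constructor
  · rintro ⟨h, hh, hcase⟩
    have heq : ∀ t ∈ Ioo (0 : ℝ) 1, h t = (reliability n S.meetsAll).eval t := fun t ht =>
      hh.eqOn S.isModule (Ioo_subset_Icc_self ht)
    rcases hcase with ⟨hω, hfix⟩ | ⟨rfl, hlt⟩ | ⟨rfl, hlt⟩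
    · have hωfix : (reliability n S.meetsAll).eval ω = ω :=
        (heq ω hω).symm.trans ((hfix ω hω).2 rfl)
      refine ⟨⟨Ioo_subset_Icc_self hω, fun t ht htω => ?_, fun t ht htω => ?_⟩, fun _ => hωfix⟩
      · by_contra hcon
        exact (S.reliability_crossing hS ht hω htω (not_lt.1 hcon)).ne' hωfix
      · exact S.reliability_crossing hS hω ht htω hωfix.ge
    · refine ⟨⟨left_mem_Icc.2 zero_le_one, fun t ht h0 => absurd h0 ht.1.not_gt,
        fun t ht _ => (hlt t ht).trans_eq (heq t ht)⟩, fun h0 => absurd h0.1 (lt_irrefl _)⟩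
    · refine ⟨⟨right_mem_Icc.2 zero_le_one, fun t ht _ => (heq t ht).symm.trans_lt (hlt t ht),
        fun t ht h1 => absurd h1 ht.2.not_gt⟩, fun h1 => absurd h1.2 (lt_irrefl _)⟩
  · rintro ⟨⟨hω, hlo, hhi⟩, hfix⟩
    refine ⟨_, S.isModule, ?_⟩
    rcases hω.1.eq_or_lt with rfl | h0
    · exact Or.inr (Or.inl ⟨rfl, fun t ht => hhi t ht ht.1⟩)
    rcases hω.2.eq_or_lt with rfl | h1
    · exact Or.inr (Or.inr ⟨rfl, fun t ht => hlo t ht ht.2⟩)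
    refine Or.inl ⟨⟨h0, h1⟩, fun t ht => ⟨fun h => ?_, fun h => h ▸ hfix ⟨h0, h1⟩⟩⟩
    rcases lt_trichotomy t ω with hlt | heq | hgt
    · exact absurd h (hlo t ht hlt).ne
    · exact heq
    · exact absurd h (hhi t ht hgt).ne'

/-- A singleton puts the module weakly below the diagonal and a common point weakly above it, and the
single upward crossing makes these inequalities strict. Without either there is an interior fixed
point, and the crossing makes it the only one. -/
theorem SpernerFamily.exists_isSpernerPoint {n : ℕ} {S : SpernerFamily n}
    (hS : ¬ IsProjection S.statistic) :
    ∃ ω, IsSpernerPoint S.statistic ω ∧ (ω = 1 ↔ S.HasSingleton ∧ ¬ S.HasCommonPoint) ∧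
      (ω = 0 ↔ ¬ S.HasSingleton ∧ S.HasCommonPoint) := by
  have hnot := not_singleton_and_common hS
  by_cases hs : S.HasSingleton
  · have hc : ¬ S.HasCommonPoint := fun hc => hnot ⟨hs, hc⟩
    refine ⟨1, ⟨_, S.isModule, Or.inr (Or.inr ⟨rfl, fun t ht => ?_⟩)⟩, by simp [hs, hc],
      by simp [hs]⟩
    by_contra hcon
    obtain ⟨u, hu, hu'⟩ := exists_between ht.2
    have hu01 : u ∈ Ioo (0 : ℝ) 1 := ⟨ht.1.trans hu, hu'⟩
    exact (S.reliability_crossing hS ht hu01 hu (not_lt.1 hcon)).not_ge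
      (reliability_le hs (Ioo_subset_Icc_self hu01))
  by_cases hc : S.HasCommonPoint
  · refine ⟨0, ⟨_, S.isModule, Or.inr (Or.inl ⟨rfl, fun t ht => ?_⟩)⟩, by simp [hs],
      by simp [hs, hc]⟩
    obtain ⟨u, hu, hu'⟩ := exists_between ht.1
    have hu01 : u ∈ Ioo (0 : ℝ) 1 := ⟨hu, hu'.trans ht.2⟩
    exact S.reliability_crossing hS hu01 ht hu' (le_reliability hc (Ioo_subset_Icc_self hu01))
  · obtain ⟨ω, hω, hfix⟩ := exists_fixedPoint hs hc
    refine ⟨ω, (isSpernerPoint_iff hS ω).2 ⟨⟨Ioo_subset_Icc_self hω, fun t ht htω => ?_,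
      fun t ht htω => S.reliability_crossing hS hω ht htω hfix.ge⟩, fun _ => hfix⟩,
      by simp [hs, hω.2.ne], by simp [hc, hω.1.ne']⟩
    by_contra hcon
    exact (S.reliability_crossing hS ht hω htω (not_lt.1 hcon)).ne' hfix

theorem SpernerFamily.isSpernerPoint_unique {n : ℕ} {S : SpernerFamily n}
    (hS : ¬ IsProjection S.statistic) {ω ω' : ℝ} (h : IsSpernerPoint S.statistic ω)
    (h' : IsSpernerPoint S.statistic ω') : ω = ω' :=
  ((isSpernerPoint_iff hS ω).1 h).1.unique ((isSpernerPoint_iff hS ω').1 h').1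

/-! ### Iterates of the module -/

/-- Iterates that decrease below `ω` converge to `0`, since their limit is a fixed point. -/
theorem tendsto_iterate_zero {g : ℝ → ℝ} (hg : Continuous g) {ω : ℝ} (h0 : g 0 = 0)
    (hlt : ∀ t ∈ Ioo 0 ω, 0 ≤ g t ∧ g t < t) {t : ℝ} (ht : t ∈ Ico 0 ω) :
    Tendsto (fun N => g^[N] t) atTop (𝓝 0) := by
  have hstep : ∀ u ∈ Ico 0 ω, 0 ≤ g u ∧ g u ≤ u := by
    intro u hu
    rcases hu.1.eq_or_lt with rfl | hu0
    · simp [h0]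
    · exact ⟨(hlt u ⟨hu0, hu.2⟩).1, (hlt u ⟨hu0, hu.2⟩).2.le⟩
  have hmem : ∀ N, g^[N] t ∈ Ico 0 ω := by
    intro N
    induction N with
    | zero => exact ht
    | succ N ih =>
      rw [Function.iterate_succ_apply']
      exact ⟨(hstep _ ih).1, (hstep _ ih).2.trans_lt ih.2⟩
  have hanti : Antitone fun N => g^[N] t := antitone_nat_of_succ_le fun N => by
    rw [Function.iterate_succ_apply']
    exact (hstep _ (hmem N)).2
  have hbdd : BddBelow (range fun N => g^[N] t) := ⟨0, by rintro _ ⟨N, rfl⟩; exact (hmem N).1⟩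
  have hlim := tendsto_atTop_ciInf hanti hbdd
  have hl0 : 0 ≤ ⨅ N, g^[N] t := le_ciInf fun N => (hmem N).1
  have hlω : ⨅ N, g^[N] t < ω := (ciInf_le hbdd 0).trans_lt ht.2
  have hfix := isFixedPt_of_tendsto_iterate hlim hg.continuousAt
  rcases hl0.eq_or_lt with heq | hpos
  · rwa [← heq] at hlim
  · exact absurd hfix (hlt _ ⟨hpos, hlω⟩).2.ne

theorem tendsto_iterate_one {g : ℝ → ℝ} (hg : Continuous g) {ω : ℝ} (h1 : g 1 = 1)
    (hlt : ∀ t ∈ Ioo ω 1, t < g t ∧ g t ≤ 1) {t : ℝ} (ht : t ∈ Ioc ω 1) :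
    Tendsto (fun N => g^[N] t) atTop (𝓝 1) := by
  have h := tendsto_iterate_zero (g := fun u => 1 - g (1 - u)) (by fun_prop) (ω := 1 - ω)
    (by simp [h1]) (t := 1 - t) (fun u hu => by
      obtain ⟨ha, hb⟩ := hlt (1 - u) ⟨by linarith [hu.2], by linarith [hu.1]⟩
      exact ⟨by linarith, by linarith⟩) ⟨by linarith [ht.2], by linarith [ht.1]⟩
  have hsemi : Function.Semiconj (fun u : ℝ => 1 - u) g fun u => 1 - g (1 - u) := fun u => by
    simp
  have h' := h.const_sub 1
  simp only [← (hsemi.iterate_right _).eq, sub_sub_cancel, sub_zero] at h'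
  exact h'

theorem SpernerFamily.tendsto_iterate {n : ℕ} {S : SpernerFamily n}
    (hS : ¬ IsProjection S.statistic) {ω : ℝ} (hω : IsSpernerPoint S.statistic ω) {t : ℝ}
    (ht : t ∈ Icc (0 : ℝ) 1) :
    Tendsto (fun N => (fun u => (reliability n S.meetsAll).eval u)^[N] t) atTop
      (𝓝 (if t < ω then 0 else if ω < t then 1 else ω)) := by
  obtain ⟨⟨hω01, hlo, hhi⟩, hfix⟩ := (isSpernerPoint_iff hS ω).1 hω
  have hg := (reliability n S.meetsAll).continuous
  have h0 := reliability_eval_zero S.not_meetsAll_false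
  have h1 := reliability_eval_one S.meetsAll_true
  split_ifs with hlt hgt
  · refine tendsto_iterate_zero hg (ω := ω) h0 (fun u hu => ?_) ⟨ht.1, hlt⟩
    have hu' : u ∈ Ioo (0 : ℝ) 1 := ⟨hu.1, hu.2.trans_le hω01.2⟩
    exact ⟨(reliability_mem_Icc _ (Ioo_subset_Icc_self hu')).1, hlo u hu' hu.2⟩
  · refine tendsto_iterate_one hg (ω := ω) h1 (fun u hu => ?_) ⟨hgt, ht.2⟩
    have hu' : u ∈ Ioo (0 : ℝ) 1 := ⟨hω01.1.trans_lt hu.1, hu.2⟩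
    exact ⟨hhi u hu' hu.1, (reliability_mem_Icc _ (Ioo_subset_Icc_self hu')).2⟩
  · have hfix' : Function.IsFixedPt (fun u => (reliability n S.meetsAll).eval u) ω := by
      rcases hω01.1.eq_or_lt with rfl | hpos
      · exact h0
      rcases hω01.2.eq_or_lt with rfl | hlt1
      · exact h1
      exact hfix ⟨hpos, hlt1⟩
    rw [le_antisymm (not_lt.1 hgt) (not_lt.1 hlt)]
    simp only [fun N => (hfix'.iterate N).eq]
    exact tendsto_const_nhds

/-! ### Convergence to two-point laws -/

theorem lt_leftQuantile_iff {μ : Measure ℝ} {η : ℝ} {x : EReal} :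
    x < leftQuantile μ η ↔ ∃ t : ℝ, cdf μ t < η ∧ x < t := by
  simp [leftQuantile, lt_sSup_iff]

theorem rightQuantile_lt_iff {μ : Measure ℝ} {η : ℝ} {x : EReal} :
    rightQuantile μ η < x ↔ ∃ t : ℝ, η < cdf μ t ∧ (t : EReal) < x := by
  simp [rightQuantile, sInf_lt_iff]

theorem cdf_lt_of_lt_leftQuantile {μ : Measure ℝ} {η x : ℝ}
    (h : (x : EReal) < leftQuantile μ η) : cdf μ x < η := by
  obtain ⟨t, ht, hxt⟩ := lt_leftQuantile_iff.1 h
  exact (monotone_cdf μ (EReal.coe_lt_coe_iff.1 hxt).le).trans_lt ht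

theorem lt_cdf_of_rightQuantile_lt {μ : Measure ℝ} {η x : ℝ}
    (h : rightQuantile μ η < (x : EReal)) : η < cdf μ x := by
  obtain ⟨t, ht, hxt⟩ := rightQuantile_lt_iff.1 h
  exact ht.trans_le (monotone_cdf μ (EReal.coe_lt_coe_iff.1 hxt).le)

theorem leftQuantile_le_rightQuantile (μ : Measure ℝ) (η : ℝ) :
    leftQuantile μ η ≤ rightQuantile μ η := by
  by_contra! h
  obtain ⟨x, hx, hx'⟩ := EReal.exists_between_coe_real h
  exact lt_asymm (cdf_lt_of_lt_leftQuantile hx') (lt_cdf_of_rightQuantile_lt hx)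

theorem cdf_eq_of_between_quantiles {μ : Measure ℝ} {η x : ℝ}
    (h : leftQuantile μ η < (x : EReal)) (h' : (x : EReal) < rightQuantile μ η) :
    cdf μ x = η := by
  refine le_antisymm (not_lt.1 fun hlt => ?_) (not_lt.1 fun hlt => ?_)
  · exact h'.not_ge (sInf_le ⟨x, hlt, rfl⟩)
  · exact h.not_ge (le_sSup ⟨x, hlt, rfl⟩)

/-- If the mass of `(-∞, l]` vanishes asymptotically for all `l < a`, then the part of `(-∞, a)`
outside a neighbourhood `U` of `a` lies in a measurable set `D` of asymptotically vanishing mass. -/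
theorem exists_null_below {m : ℕ → Measure ℝ} [∀ N, IsProbabilityMeasure (m N)] {a : EReal}
    (ha : ∀ l : ℝ, (l : EReal) < a → Tendsto (fun N => cdf (m N) l) atTop (𝓝 0)) {U : Set EReal}
    (hU : U ∈ 𝓝 a) : ∃ D : Set ℝ, Tendsto (fun N => (m N).real D) atTop (𝓝 0) ∧
      ∀ x : ℝ, (x : EReal) ≤ a → (x : EReal) ∉ U → x ∈ D := by
  by_cases hbot : a = ⊥
  · refine ⟨∅, by simp, fun x hx => ?_⟩
    simp [hbot] at hx
  · obtain ⟨l, hl, hlU⟩ := exists_Ioc_subset_of_mem_nhds hU ⟨⊥, bot_lt_iff_ne_bot.2 hbot⟩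
    obtain ⟨r, hr, hra⟩ := EReal.exists_between_coe_real hl
    refine ⟨Iic r, by simpa only [cdf_eq_real] using ha r hra, fun x hx hxU => ?_⟩
    by_contra hxr
    have hxr' : (r : EReal) < x := EReal.coe_lt_coe_iff.2 (not_le.1 hxr)
    exact hxU (hlU ⟨hr.trans hxr', hx⟩)

theorem exists_null_above {m : ℕ → Measure ℝ} [∀ N, IsProbabilityMeasure (m N)] {b : EReal}
    (hb : ∀ r : ℝ, b < (r : EReal) → Tendsto (fun N => cdf (m N) r) atTop (𝓝 1)) {U : Set EReal}
    (hU : U ∈ 𝓝 b) : ∃ D : Set ℝ, Tendsto (fun N => (m N).real D) atTop (𝓝 0) ∧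
      ∀ x : ℝ, b ≤ (x : EReal) → (x : EReal) ∉ U → x ∈ D := by
  by_cases htop : b = ⊤
  · refine ⟨∅, by simp, fun x hx => ?_⟩
    simp [htop] at hx
  · obtain ⟨u, hu, huU⟩ := exists_Ico_subset_of_mem_nhds hU ⟨⊤, lt_top_iff_ne_top.2 htop⟩
    obtain ⟨r, hr, hru⟩ := EReal.exists_between_coe_real hu
    refine ⟨Ioi r, ?_, fun x hx hxU => ?_⟩
    · have h := (hb r hr).const_sub 1
      simp only [cdf_eq_real, sub_self] at h
      simpa only [← compl_Iic, probReal_compl_eq_one_sub measurableSet_Iic] using h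
    · by_contra hxr
      have hxr' : (x : EReal) ≤ r := EReal.coe_le_coe_iff.2 (not_lt.1 hxr)
      exact hxU (huU ⟨hx, hxr'.trans_lt hru⟩)

theorem ofReal_le_liminf_measure {m : ℕ → Measure ℝ} [∀ N, IsProbabilityMeasure (m N)]
    {V : Set ℝ} {s : ℕ → ℝ} {c : ℝ} (hs : Tendsto s atTop (𝓝 c))
    (hle : ∀ N, s N ≤ (m N).real V) :
    ENNReal.ofReal c ≤ liminf (fun N => m N V) atTop := by
  rw [← (ENNReal.tendsto_ofReal hs).liminf_eq]
  refine liminf_le_liminf (Eventually.of_forall fun N => ?_)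
  exact ENNReal.ofReal_le_of_le_toReal (hle N)

/-- Convergence of distribution functions to those of a two-point law on the extended line implies
the lower bound of the portmanteau theorem for open sets. -/
theorem twoPoint_le_liminf {m : ℕ → Measure ℝ} [∀ N, IsProbabilityMeasure (m N)] {a b : EReal}
    (hab : a ≤ b) {ω : ℝ} (hω : ω ∈ Icc (0 : ℝ) 1)
    (ha : ∀ l : ℝ, (l : EReal) < a → Tendsto (fun N => cdf (m N) l) atTop (𝓝 0))
    (hb : ∀ r : ℝ, b < (r : EReal) → Tendsto (fun N => cdf (m N) r) atTop (𝓝 1))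
    (hm : ∀ c : ℝ, a < (c : EReal) → (c : EReal) < b →
      Tendsto (fun N => cdf (m N) c) atTop (𝓝 ω)) {U : Set EReal} (hU : IsOpen U) :
    (ENNReal.ofReal ω • Measure.dirac a + ENNReal.ofReal (1 - ω) • Measure.dirac b) U ≤
      liminf (fun N => m N ((fun x : ℝ => (x : EReal)) ⁻¹' U)) atTop := by
  set V : Set ℝ := (fun x : ℝ => (x : EReal)) ⁻¹' U
  have hω1 : 0 ≤ 1 - ω := sub_nonneg.2 hω.2
  rcases hab.eq_or_lt with rfl | hlt
  · by_cases haU : a ∈ U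
    · obtain ⟨D, hD, hDU⟩ := exists_null_below ha (hU.mem_nhds haU)
      obtain ⟨E, hE, hEU⟩ := exists_null_above hb (hU.mem_nhds haU)
      have hcov : (univ : Set ℝ) ⊆ V ∪ (D ∪ E) := by
        intro x _
        by_cases hx : (x : EReal) ∈ U
        · exact Or.inl hx
        · rcases le_total (x : EReal) a with h | h
          · exact Or.inr (Or.inl (hDU x h hx))
          · exact Or.inr (Or.inr (hEU x h hx))
      have hs := (hD.add hE).const_sub 1
      have key := ofReal_le_liminf_measure (m := m) (V := V) hs fun N => by
        have h1 := measureReal_mono (μ := m N) hcov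
        have h2 := measureReal_union_le (μ := m N) V (D ∪ E)
        have h3 := measureReal_union_le (μ := m N) D E
        rw [probReal_univ] at h1
        linarith
      have h1 : ENNReal.ofReal ω + ENNReal.ofReal (1 - ω) = 1 := by
        rw [← ENNReal.ofReal_add hω.1 hω1]; simp
      simpa [haU, h1] using key
    · simp [haU]
  · -- Separate the two atoms by a real number `c`.
    obtain ⟨c, hac, hcb⟩ := EReal.exists_between_coe_real hlt
    have hA : a ∈ U → ∃ s : ℕ → ℝ, Tendsto s atTop (𝓝 ω) ∧
        ∀ N, s N ≤ (m N).real (V ∩ Iic c) := by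
      intro haU
      obtain ⟨D, hD, hDU⟩ := exists_null_below ha (hU.mem_nhds haU)
      obtain ⟨u, hu, huU⟩ := exists_Ico_subset_of_mem_nhds' (hU.mem_nhds haU) hac
      obtain ⟨d, had, hdu⟩ := EReal.exists_between_coe_real hu.1
      have hdc : (d : EReal) < c := hdu.trans_le hu.2
      refine ⟨_, by simpa using (hm d had (hdc.trans hcb)).sub hD, fun N => ?_⟩
      have hcov : Iic d ⊆ V ∩ Iic c ∪ D := by
        intro x hx
        have hxd : (x : EReal) ≤ d := EReal.coe_le_coe_iff.2 hx
        by_cases hxU : (x : EReal) ∈ U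
        · exact Or.inl ⟨hxU, EReal.coe_le_coe_iff.1 (hxd.trans hdc.le)⟩
        · refine Or.inr (hDU x (not_lt.1 fun hax => hxU ?_) hxU)
          exact huU ⟨hax.le, hxd.trans_lt hdu⟩
      have h1 := measureReal_mono (μ := m N) hcov
      have h2 := measureReal_union_le (μ := m N) (V ∩ Iic c) D
      rw [cdf_eq_real]
      linarith
    have hB : b ∈ U → ∃ s : ℕ → ℝ, Tendsto s atTop (𝓝 (1 - ω)) ∧
        ∀ N, s N ≤ (m N).real (V ∩ Ioi c) := by
      intro hbU
      obtain ⟨D, hD, hDU⟩ := exists_null_above hb (hU.mem_nhds hbU)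
      obtain ⟨l, hl, hlU⟩ := exists_Ioc_subset_of_mem_nhds' (hU.mem_nhds hbU) hcb
      obtain ⟨d, hld, hdb⟩ := EReal.exists_between_coe_real hl.2
      have hcd : (c : EReal) < d := hl.1.trans_lt hld
      refine ⟨_, by simpa using ((hm d (hac.trans hcd) hdb).const_sub 1).sub hD, fun N => ?_⟩
      have hcov : Ioi d ⊆ V ∩ Ioi c ∪ D := by
        intro x hx
        have hxd : (d : EReal) < x := EReal.coe_lt_coe_iff.2 hx
        by_cases hxU : (x : EReal) ∈ U
        · exact Or.inl ⟨hxU, EReal.coe_lt_coe_iff.1 (hcd.trans hxd)⟩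
        · refine Or.inr (hDU x (not_lt.1 fun hxb => hxU ?_) hxU)
          exact hlU ⟨hld.trans hxd, hxb.le⟩
      have h1 := measureReal_mono (μ := m N) hcov
      have h2 := measureReal_union_le (μ := m N) (V ∩ Ioi c) D
      have h3 := probReal_compl_eq_one_sub (μ := m N) (measurableSet_Iic (a := d))
      rw [compl_Iic] at h3
      rw [cdf_eq_real]
      linarith
    by_cases haU : a ∈ U <;> by_cases hbU : b ∈ U
    · obtain ⟨s, hs, hsV⟩ := hA haU
      obtain ⟨s', hs', hsV'⟩ := hB hbU
      have key := ofReal_le_liminf_measure (m := m) (V := V) (hs.add hs') fun N => by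
        have h := measureReal_inter_add_sdiff (μ := m N) (s := V) (measurableSet_Iic (a := c))
        rw [sdiff_eq, compl_Iic] at h
        linarith [hsV N, hsV' N]
      rw [ENNReal.ofReal_add hω.1 hω1] at key
      simpa [haU, hbU] using key
    · obtain ⟨s, hs, hsV⟩ := hA haU
      have key := ofReal_le_liminf_measure (m := m) (V := V) hs fun N =>
        (hsV N).trans (measureReal_mono inter_subset_left)
      simpa [haU, hbU] using key
    · obtain ⟨s, hs, hsV⟩ := hB hbU
      have key := ofReal_le_liminf_measure (m := m) (V := V) hs fun N =>
        (hsV N).trans (measureReal_mono inter_subset_left)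
      simpa [haU, hbU] using key
    · simp [haU, hbU]

/-! ### Convergence of the iterated laws -/

/-- The bound is stated for the real traces of open sets of extended reals, so that it serves both
the convergence on `[-∞, ∞]` and, as `ℝ` is open there, the convergence on `ℝ`. -/
theorem SpernerFamily.quantileLaw_le_liminf {n : ℕ} {S : SpernerFamily n}
    (hS : ¬ IsProjection S.statistic) {ω : ℝ} (hω : IsSpernerPoint S.statistic ω)
    (μ : Measure ℝ) [IsProbabilityMeasure μ] {U : Set EReal} (hU : IsOpen U) :
    quantileLaw μ ω U ≤
      liminf (fun N => iterateLaw S.statistic N μ ((fun x : ℝ => (x : EReal)) ⁻¹' U)) atTop := by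
  have hp : ∀ N, IsProbabilityMeasure (iterateLaw S.statistic N μ) :=
    fun N => (S.iterateLaw_cdf N μ).1
  have hlim : ∀ x : ℝ, Tendsto (fun N => cdf (iterateLaw S.statistic N μ) x) atTop
      (𝓝 (if cdf μ x < ω then 0 else if ω < cdf μ x then 1 else ω)) := by
    intro x
    simp only [fun N => (S.iterateLaw_cdf N μ).2 x]
    exact S.tendsto_iterate hS hω ⟨cdf_nonneg μ x, cdf_le_one μ x⟩
  refine twoPoint_le_liminf (leftQuantile_le_rightQuantile μ ω)
    ((isSpernerPoint_iff hS ω).1 hω).1.1 (fun l hl => ?_) (fun r hr => ?_)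
    (fun c hac hcb => ?_) hU
  · simpa [cdf_lt_of_lt_leftQuantile hl] using hlim l
  · have h := lt_cdf_of_rightQuantile_lt hr
    simpa [h, h.not_gt] using hlim r
  · simpa [cdf_eq_of_between_quantiles hac hcb] using hlim c

/-- Selectors are exactly the Sperner statistics. A Sperner statistic other than a projection has
exactly one Sperner point `p`; it is `1` exactly in the lower case, `0` exactly in the upper case
and lies in `(0, 1)` otherwise; and the iterates `Y N` of the statistic on any real random
variable `X` converge in distribution, as random variables with values in `[-∞, ∞]`, to the
`p`-quantile `Z` of `X`. If that quantile is real-valued, the convergence takes place in `ℝ`. -/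
theorem mainTheorem1 {n : ℕ} (H : (Fin n → ℝ) → ℝ) :
    (IsSelector H ↔ IsSpernerStatistic H) ∧
    (IsSpernerStatistic H → ¬ IsProjection H →
      (∃! p : ℝ, IsSpernerPoint H p) ∧
      ∀ p : ℝ, IsSpernerPoint H p →
        (∀ S : SpernerFamily n, H = S.statistic →
          (p = 1 ↔ S.HasSingleton ∧ ¬ S.HasCommonPoint) ∧
          (p = 0 ↔ ¬ S.HasSingleton ∧ S.HasCommonPoint)) ∧
        ∀ {Ω : Type*} [MeasurableSpace Ω] (P : Measure Ω) [IsProbabilityMeasure P]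
          (X : Ω → ℝ), AEMeasurable X P →
        ∀ {Ω' : ℕ → Type*} [∀ N, MeasurableSpace (Ω' N)] (P' : ∀ N, Measure (Ω' N))
          [∀ N, IsProbabilityMeasure (P' N)] (Y : ∀ N, Ω' N → ℝ),
          (∀ N, HasLaw (Y N) (iterateLaw H N (P.map X)) (P' N)) →
        ∀ {Ω'' : Type*} [MeasurableSpace Ω''] (P'' : Measure Ω'') [IsProbabilityMeasure P''],
          (∀ Z : Ω'' → EReal, HasLaw Z (quantileLaw (P.map X) p) P'' →
            TendstoInDistribution (fun N ω => ((Y N ω : ℝ) : EReal)) atTop Z P' P'') ∧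
          (∀ Z : Ω'' → ℝ, HasLaw (fun ω => (Z ω : EReal)) (quantileLaw (P.map X) p) P'' →
            TendstoInDistribution Y atTop Z P' P'')) := by
  refine ⟨isSelector_iff_isSpernerStatistic H, ?_⟩
  rintro ⟨S, rfl⟩ hS
  obtain ⟨p₀, hp₀, -⟩ := S.exists_isSpernerPoint hS
  refine ⟨⟨p₀, hp₀, fun q hq => SpernerFamily.isSpernerPoint_unique hS hq hp₀⟩,
    fun p hp => ⟨fun T hT => ?_, ?_⟩⟩
  · rw [hT] at hS hp
    obtain ⟨q, hq, hq1, hq0⟩ := T.exists_isSpernerPoint hS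
    rw [SpernerFamily.isSpernerPoint_unique hS hp hq]
    exact ⟨hq1, hq0⟩
  intro Ω _ P _ X hX Ω' _ P' _ Y hY Ω'' _ P'' _
  have hμ : IsProbabilityMeasure (P.map X) := Measure.isProbabilityMeasure_map hX
  have hYm : ∀ N, AEMeasurable (Y N) (P' N) := fun N => (hY N).aemeasurable
  have hYm' : ∀ N, AEMeasurable (fun ω => ((Y N ω : ℝ) : EReal)) (P' N) :=
    fun N => measurable_coe_real_ereal.comp_aemeasurable (hYm N)
  refine ⟨fun Z hZ => ⟨hYm', hZ.aemeasurable, ?_⟩, fun Z hZ => ?_⟩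
  · refine tendsto_of_forall_isOpen_le_liminf' fun U hU => ?_
    simp only [ProbabilityMeasure.coe_mk]
    rw [hZ.map_eq]
    refine (S.quantileLaw_le_liminf hS hp (P.map X) hU).trans_eq ?_
    congr 1 with N
    rw [← (hY N).map_eq, Measure.map_apply_of_aemeasurable (hYm' N) hU.measurableSet,
      Measure.map_apply_of_aemeasurable (hYm N) (measurable_coe_real_ereal hU.measurableSet)]
    rfl
  · have hZm : AEMeasurable Z P'' := by
      simpa [Function.comp_def] using measurable_ereal_toReal.comp_aemeasurable hZ.aemeasurable
    refine ⟨hYm, hZm, tendsto_of_forall_isOpen_le_liminf' fun U hU => ?_⟩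
    simp only [ProbabilityMeasure.coe_mk]
    have hU' : IsOpen ((fun x : ℝ => (x : EReal)) '' U) :=
      EReal.isOpenEmbedding_coe.isOpenMap U hU
    have hpre : (fun x : ℝ => (x : EReal)) ⁻¹' ((fun x : ℝ => (x : EReal)) '' U) = U :=
      preimage_image_eq U EReal.coe_injective
    have h := S.quantileLaw_le_liminf hS hp (P.map X) hU'
    rw [hpre, ← hZ.map_eq, Measure.map_apply_of_aemeasurable hZ.aemeasurable hU'.measurableSet] at h
    rw [Measure.map_apply_of_aemeasurable hZm hU.measurableSet]
    simp only [fun N => (hY N).map_eq]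
    refine le_trans (le_of_eq ?_) h
    congr 1
    ext ω
    simp
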